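/- Let $n\ge 1$, and let $\lambda(x)=\sum_{i\ge1}\lambda_i x^{i-1}$ and $\rho(x)=\sum_{i\ge1}\rho_i x^{i-1}$ be degree distributions from the edge perspective (polynomials with non-negative coefficients and $\lambda(1)=\rho(1)=1$) for which the ensemble $\mathrm{LDPC}(n,\lambda,\rho)$ exists, i.e. there are positive degrees for $n$ variable nodes and for some number $m$ of parity-check nodes, with the same sum $E$ on both sides, such that for every $i\ge1$ a fraction $\lambda_i$ of the $E$ edges is attached to variable nodes of degree $i$ and a fraction $\rho_i$ to parity-check nodes of degree $i$. A graph from the ensemble is the bipartite multigraph $\mathcal G$ obtained by giving each node of degree $d$ exactly $d$ sockets and joining the variable-node sockets to the check-node sockets by a bijection, one edge for each pair; let $\mathcal G$ be chosen uniformly at random, i.e. let the bijection be uniformly distributed. Let $\beta(\mathcal G)=|E(\mathcal G)|-|V(\mathcal G)|+c(\mathcal G)$ be the cardinality of the fundamental system of cycles (the cyclomatic number) of $\mathcal G$, where $E(\mathcal G)$ is the set of edges (parallel edges are counted with multiplicity), $V(\mathcal G)$ the set of vertices and $c(\mathcal G)$ the number of connected components. Let $$R_{\mathrm d}=1-\frac{\int_0^1\rho(x)\,dx}{\int_0^1\lambda(x)\,dx},\qquad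 a_{\mathrm R}=\frac1{\int_0^1\rho(x)\,dx}$$ be the design rate and the average right degree, and let $h_2(x)=-x\log_2 x-(1-x)\log_2(1-x)$ on $[0,1]$ be the binary entropy function to the base $2$ (with $0\log_2 0=0$). Then, for every $\alpha\ge0$, with $\beta=\dfrac{\alpha}{(1-R_{\mathrm d})\,a_{\mathrm R}}$: if $\beta\le1$, then $$\mathbb P\bigl(|\beta(\mathcal G)-\mathbb E[\beta(\mathcal G)]|\ge\alpha n\bigr)\le 2\cdot2^{-\left[1-h_2\left(\frac{1-\beta}{2}\right)\right]n},$$ and if $\beta>1$, then this probability is zero. -/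

import Mathlib

open MeasureTheory ProbabilityTheory Polynomial

noncomputable section

/-- The binary entropy function to the base `2`. -/
def h2 (x : ℝ) : ℝ :=
  -x * Real.logb 2 x - (1 - x) * Real.logb 2 (1 - x)

/-- The number of connected components of a multigraph `G`.
Parallel edges and loops do not matter for connectedness, so these are the connected components
of the underlying simple graph on the vertex set of `G`. -/
def Graph.numComponents {V E : Type*} (G : Graph V E) : ℕ :=
  Nat.card G.toSimpleGraph.ConnectedComponent

/-- The cardinality of the fundamental system of cycles (the cyclomatic number) of a finite
multigraph `G`: `β(G) = |E(G)| - |V(G)| + c(G)`. Parallel edges are counted with multiplicity. -/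
def Graph.cyclomaticNumber {V E : Type*} (G : Graph V E) : ℤ :=
  (G.edgeSet.ncard : ℤ) - (G.vertexSet.ncard : ℤ) + (G.numComponents : ℤ)

/-- A degree distribution from the edge perspective, `p(x) = ∑_{i ≥ 1} p_i x^(i-1)`: the `p_i`
are non-negative and sum to `1`. The number `p_i` is `p.coeff (i - 1)`. -/
def IsDegreeDistribution (p : ℝ[X]) : Prop :=
  (∀ i, 0 ≤ p.coeff i) ∧ p.eval 1 = 1

/-- The design rate `R_d = 1 - (∫₀¹ ρ) / (∫₀¹ λ)`. -/
def designRate (lam rho : ℝ[X]) : ℝ :=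
  1 - (∫ x in (0 : ℝ)..1, rho.eval x) / (∫ x in (0 : ℝ)..1, lam.eval x)

/-- The average right degree `a_R = 1 / ∫₀¹ ρ`. -/
def avgRightDegree (rho : ℝ[X]) : ℝ :=
  1 / (∫ x in (0 : ℝ)..1, rho.eval x)

/-- The data of the ensemble `LDPC(n, λ, ρ)`: `n` variable nodes, some number `m` of parity-check
nodes, and a (fixed, arbitrary) assignment of positive degrees to the nodes, such that both sides
have the same total number of edge ends (sockets) and such that, for every degree `i ≥ 1`, the
fraction of the edges attached to variable nodes of degree `i` is `λ_i` and the fraction of the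
edges attached to parity-check nodes of degree `i` is `ρ_i`. The assignment is determined by
`n`, `λ`, `ρ` up to a relabelling of the nodes on each side. -/
structure LDPC (n : ℕ) (lam rho : ℝ[X]) where
  /-- The number of parity-check nodes. -/
  m : ℕ
  /-- The degrees of the variable nodes. -/
  leftDeg : Fin n → ℕ
  /-- The degrees of the parity-check nodes. -/
  rightDeg : Fin m → ℕ
  leftDeg_pos : ∀ v, 0 < leftDeg v
  rightDeg_pos : ∀ c, 0 < rightDeg c
  sum_leftDeg_eq : ∑ v, leftDeg v = ∑ c, rightDeg c
  /-- The `i * #{v | deg v = i}` edges at variable nodes of degree `i` are a fraction `λ_i`. -/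
  left_fraction : ∀ i : ℕ, 1 ≤ i →
    (i : ℝ) * ((Finset.univ.filter fun v => leftDeg v = i).card : ℝ)
      = lam.coeff (i - 1) * ((∑ v, leftDeg v : ℕ) : ℝ)
  /-- The `i * #{c | deg c = i}` edges at check nodes of degree `i` are a fraction `ρ_i`. -/
  right_fraction : ∀ i : ℕ, 1 ≤ i →
    (i : ℝ) * ((Finset.univ.filter fun c => rightDeg c = i).card : ℝ)
      = rho.coeff (i - 1) * ((∑ c, rightDeg c : ℕ) : ℝ)

namespace LDPC

variable {n : ℕ} {lam rho : ℝ[X]}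

/-- The sockets of the variable nodes: a node of degree `d` has `d` sockets. -/
abbrev LeftSocket (𝓔 : LDPC n lam rho) : Type := Σ v : Fin n, Fin (𝓔.leftDeg v)

/-- The sockets of the parity-check nodes: a node of degree `d` has `d` sockets. -/
abbrev RightSocket (𝓔 : LDPC n lam rho) : Type := Σ c : Fin 𝓔.m, Fin (𝓔.rightDeg c)

/-- The elements of the ensemble: the ways to connect each socket of a variable node to its own
socket of a parity-check node. -/
abbrev Config (𝓔 : LDPC n lam rho) : Type := 𝓔.LeftSocket ≃ 𝓔.RightSocket

/-- All sets of elements of the (finite) ensemble are events. -/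
instance (𝓔 : LDPC n lam rho) : MeasurableSpace 𝓔.Config := ⊤

/-- The uniform probability measure on the ensemble. -/
def law (𝓔 : LDPC n lam rho) : Measure 𝓔.Config := uniformOn Set.univ

/-- The bipartite multigraph of an element of the ensemble. The vertices are the `n` variable
nodes and the `m` parity-check nodes; there is one edge for each socket `s` of a variable node,
and it joins the variable node of `s` to the parity-check node of the socket `σ s`. -/
def graph (𝓔 : LDPC n lam rho) (σ : 𝓔.Config) : Graph (Fin n ⊕ Fin 𝓔.m) 𝓔.LeftSocket where
  vertexSet := Set.univ
  edgeSet := Set.univ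
  IsLink s x y :=
    (x = Sum.inl s.1 ∧ y = Sum.inr (σ s).1) ∨ (x = Sum.inr (σ s).1 ∧ y = Sum.inl s.1)
  isLink_symm _ _ := ⟨fun _ _ h => h.elim (fun h => Or.inr ⟨h.2, h.1⟩) fun h => Or.inl ⟨h.2, h.1⟩⟩
  eq_or_eq_of_isLink_of_isLink := by
    rintro s x y v w (⟨rfl, rfl⟩ | ⟨rfl, rfl⟩) (⟨rfl, rfl⟩ | ⟨rfl, rfl⟩) <;> simp
  edge_mem_iff_exists_isLink s :=
    ⟨fun _ => ⟨Sum.inl s.1, Sum.inr (σ s).1, Or.inl ⟨rfl, rfl⟩⟩, fun _ => Set.mem_univ s⟩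
  left_mem_of_isLink _ _ _ _ := Set.mem_univ _

/-- The cardinality of the fundamental system of cycles of the random graph, as a real random
variable on the ensemble. -/
def beta (𝓔 : LDPC n lam rho) (σ : 𝓔.Config) : ℝ := ((𝓔.graph σ).cyclomaticNumber : ℝ)

end LDPC

end

/-! Exchanging the check-side ends of two edges changes the number of components, hence `beta`, by
at most 1 (`LDPC.abs_beta_swap_sub_le`). Reveal the random bijection one socket at a time. Fibres
over two values of the revealed socket correspond under a bijection that moves each configuration by
at most one transposition, so their conditional means differ by at most 1. Each of the E revelations
therefore multiplies the centred exponential moment by at most `cosh s`, for a total of `cosh s ^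
E`; on permutations this martingale argument is an induction on the number of points
(`Equiv.Perm.sum_exp_sub_mean_le`).

Since (1 - R_d) a_R is the average left degree E/n, the threshold αn equals bE. Chernoff's bound
with s = artanh b gives the exponent (1 - h2((1-b)/2))E, and E ≥ n weakens it to the stated one. For
b ≥ 1 the event is empty, since the component count lies between 1 and n ≤ E. -/

/-! ### Centred exponential moments on finite types -/

theorem sum_sub_mean_eq_zero {ι : Type*} [Fintype ι] [Nonempty ι] (g : ι → ℝ) :
    ∑ i, (g i - (∑ j, g j) / Fintype.card ι) = 0 := by
  have : (Fintype.card ι : ℝ) ≠ 0 := by simp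
  simp only [Finset.sum_sub_distrib, Finset.sum_const, Finset.card_univ, nsmul_eq_mul]
  field_simp
  ring

theorem abs_sub_mean_le {ι : Type*} [Fintype ι] [Nonempty ι] (g : ι → ℝ) (i : ι) {c : ℝ}
    (h : ∀ j, |g i - g j| ≤ c) : |g i - (∑ j, g j) / Fintype.card ι| ≤ c := by
  have hc : (0 : ℝ) < Fintype.card ι := by exact_mod_cast Fintype.card_pos
  have : g i - (∑ j, g j) / Fintype.card ι = (∑ j, (g i - g j)) / Fintype.card ι := by
    simp only [Finset.sum_sub_distrib, Finset.sum_const, Finset.card_univ, nsmul_eq_mul]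
    field_simp
  rw [this, abs_div, abs_of_pos hc, div_le_iff₀ hc]
  calc |∑ j, (g i - g j)| ≤ ∑ j, |g i - g j| := Finset.abs_sum_le_sum_abs _ _
    _ ≤ ∑ _j : ι, c := Finset.sum_le_sum fun j _ => h j
    _ = c * Fintype.card ι := by simp [mul_comm]

/-- A function on a finite type whose values differ by at most `1` has centred exponential moments
bounded by `cosh`. -/
theorem sum_exp_sub_mean_le {ι : Type*} [Fintype ι] [Nonempty ι] (s : ℝ) (g : ι → ℝ)
    (h : ∀ i j, |g i - g j| ≤ 1) :
    ∑ i, Real.exp (s * (g i - (∑ j, g j) / Fintype.card ι)) ≤ Fintype.card ι * Real.cosh s := by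
  -- Convexity: on [-1, 1] the exponential lies below its chord, whose linear part averages to zero.
  calc ∑ i, Real.exp (s * (g i - (∑ j, g j) / Fintype.card ι))
      ≤ ∑ i, (Real.cosh s + (g i - (∑ j, g j) / Fintype.card ι) * Real.sinh s) :=
        Finset.sum_le_sum fun i _ => by
          rw [mul_comm s]
          exact Real.exp_mul_le_cosh_add_mul_sinh (abs_sub_mean_le g i (h i)) s
    _ = _ := by
      rw [Finset.sum_add_distrib, ← Finset.sum_mul, sum_sub_mean_eq_zero]
      simp

/-- Exponential moments on a product, by conditioning on the first coordinate. -/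
theorem sum_exp_sub_mean_prod_le {ι κ : Type*} [Fintype ι] [Nonempty ι] [Fintype κ] [Nonempty κ]
    (s C : ℝ) (f : ι × κ → ℝ)
    (hκ : ∀ i, ∑ k, Real.exp (s * (f (i, k) - (∑ l, f (i, l)) / Fintype.card κ))
      ≤ Fintype.card κ * C)
    (hι : ∀ i j, ∃ e : Equiv.Perm κ, ∀ k, |f (i, k) - f (j, e k)| ≤ 1) :
    ∑ p, Real.exp (s * (f p - (∑ q, f q) / Fintype.card (ι × κ)))
      ≤ Fintype.card (ι × κ) * (Real.cosh s * C) := by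
  have hc : (0 : ℝ) < Fintype.card κ := by exact_mod_cast Fintype.card_pos
  have hC : 0 ≤ C := by
    have := (Finset.sum_nonneg fun k _ => (Real.exp_pos _).le).trans (hκ (Classical.arbitrary ι))
    exact nonneg_of_mul_nonneg_right this hc
  set g : ι → ℝ := fun i => (∑ l, f (i, l)) / Fintype.card κ with hg
  have hmean : (∑ q, f q) / Fintype.card (ι × κ) = (∑ i, g i) / Fintype.card ι := by
    rw [Fintype.sum_prod_type, hg, ← Finset.sum_div, Fintype.card_prod, Nat.cast_mul, div_div,
      mul_comm]
  -- The fibre bijection `e` couples the two conditional averages pointwise.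
  have hgL : ∀ i j, |g i - g j| ≤ 1 := by
    intro i j
    obtain ⟨e, he⟩ := hι i j
    have : g i - g j = (∑ k, (f (i, k) - f (j, e k))) / Fintype.card κ := by
      rw [Finset.sum_sub_distrib, Equiv.sum_comp e fun k => f (j, k), sub_div]
    rw [this, abs_div, abs_of_pos hc, div_le_one hc]
    calc |∑ k, (f (i, k) - f (j, e k))| ≤ ∑ k, |f (i, k) - f (j, e k)| :=
          Finset.abs_sum_le_sum_abs _ _
      _ ≤ ∑ _k : κ, (1 : ℝ) := Finset.sum_le_sum fun k _ => he k
      _ = Fintype.card κ := by simp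
  rw [hmean, Fintype.sum_prod_type]
  calc ∑ i, ∑ k, Real.exp (s * (f (i, k) - (∑ i, g i) / Fintype.card ι))
      = ∑ i, Real.exp (s * (g i - (∑ i, g i) / Fintype.card ι)) *
          ∑ k, Real.exp (s * (f (i, k) - g i)) := by
        refine Finset.sum_congr rfl fun i _ => ?_
        rw [Finset.mul_sum]
        refine Finset.sum_congr rfl fun k _ => ?_
        rw [← Real.exp_add]
        ring_nf
    _ ≤ ∑ i, Real.exp (s * (g i - (∑ i, g i) / Fintype.card ι)) * (Fintype.card κ * C) :=
        Finset.sum_le_sum fun i _ => mul_le_mul_of_nonneg_left (hκ i) (Real.exp_pos _).le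
    _ ≤ (Fintype.card ι * Real.cosh s) * (Fintype.card κ * C) := by
        rw [← Finset.sum_mul]
        exact mul_le_mul_of_nonneg_right (sum_exp_sub_mean_le s g hgL) (by positivity)
    _ = _ := by
        rw [Fintype.card_prod, Nat.cast_mul]
        ring

theorem sum_exp_sub_mean_congr {ι κ : Type*} [Fintype ι] [Fintype κ] (e : ι ≃ κ) (s : ℝ)
    (f : κ → ℝ) :
    ∑ k, Real.exp (s * (f k - (∑ l, f l) / Fintype.card κ))
      = ∑ i, Real.exp (s * (f (e i) - (∑ j, f (e j)) / Fintype.card ι)) := by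
  rw [e.sum_comp f, Fintype.card_congr e,
    e.sum_comp fun k => Real.exp (s * (f k - (∑ l, f l) / Fintype.card κ))]

/-! ### Uniform random permutations -/

theorem Equiv.optionCongr_mul_swap {α : Type*} [DecidableEq α] (τ : Equiv.Perm α) (x y : α) :
    Equiv.optionCongr (τ * Equiv.swap x y)
      = Equiv.optionCongr τ * Equiv.swap (some x) (some y) := by
  rw [← Equiv.optionCongr_swap]
  ext a
  cases a <;> rfl

/-- Supplies the coupling of the fibres `none ↦ some a` and `none ↦ some b`: matched permutations
differ by one transposition on the left. -/
theorem Equiv.Perm.swap_none_mul_optionCongr_swap_mul {α : Type*} [DecidableEq α] (a b : α)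
    (τ : Equiv.Perm α) :
    Equiv.swap none (some b) * Equiv.optionCongr (Equiv.swap a b * τ)
      = Equiv.swap (some a) (some b) * (Equiv.swap none (some a) * Equiv.optionCongr τ) := by
  have h : Equiv.optionCongr (Equiv.swap a b * τ)
      = Equiv.swap (some a) (some b) * Equiv.optionCongr τ := by
    rw [← Equiv.optionCongr_swap]
    ext a
    cases a <;> rfl
  rw [h, ← mul_assoc, ← mul_assoc]
  congr 1
  ext x
  rw [Equiv.Perm.mul_apply, Equiv.Perm.mul_apply]
  grind

theorem Equiv.Perm.sum_exp_sub_mean_option_le {α : Type*} [Fintype α] [DecidableEq α] (s : ℝ)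
    (ih : ∀ f : Equiv.Perm α → ℝ, (∀ σ x y, |f (σ * Equiv.swap x y) - f σ| ≤ 1) →
      ∑ σ, Real.exp (s * (f σ - (∑ τ, f τ) / Fintype.card (Equiv.Perm α)))
        ≤ Fintype.card (Equiv.Perm α) * Real.cosh s ^ Fintype.card α)
    (f : Equiv.Perm (Option α) → ℝ)
    (hf : ∀ σ x y, |f (σ * Equiv.swap x y) - f σ| ≤ 1) :
    ∑ σ, Real.exp (s * (f σ - (∑ τ, f τ) / Fintype.card (Equiv.Perm (Option α))))
      ≤ Fintype.card (Equiv.Perm (Option α)) * Real.cosh s ^ Fintype.card (Option α) := by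
  have hf' : ∀ σ x y, |f (Equiv.swap x y * σ) - f σ| ≤ 1 := by
    intro σ x y
    have := hf σ (σ.symm x) (σ.symm y)
    rwa [Equiv.mul_swap_eq_swap_mul, Equiv.apply_symm_apply, Equiv.apply_symm_apply] at this
  -- The first coordinate is the image of `none`; the second is the remaining permutation, covered
  -- by `ih`.
  have key := sum_exp_sub_mean_prod_le s (Real.cosh s ^ Fintype.card α)
    (fun p : Option α × Equiv.Perm α => f (Equiv.Perm.decomposeOption.symm p)) ?_ ?_
  · convert key using 1
    · exact sum_exp_sub_mean_congr Equiv.Perm.decomposeOption.symm s f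
    · rw [Fintype.card_option, pow_succ', ← Fintype.card_congr (Equiv.Perm.decomposeOption (α := α))]
  · intro i
    refine ih (fun τ => f (Equiv.Perm.decomposeOption.symm (i, τ))) ?_
    intro σ x y
    simp only [Equiv.Perm.decomposeOption_symm_apply]
    rw [Equiv.optionCongr_mul_swap, ← mul_assoc]
    exact hf _ _ _
  · intro i j
    simp only [Equiv.Perm.decomposeOption_symm_apply]
    rcases i with _ | a <;> rcases j with _ | b
    · exact ⟨1, fun k => by simp⟩
    · refine ⟨1, fun k => ?_⟩
      rw [abs_sub_comm]
      rw [Equiv.swap_self, ← Equiv.Perm.one_def, one_mul, Equiv.Perm.one_apply]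
      exact hf' (Equiv.optionCongr k) none (some b)
    · refine ⟨1, fun k => ?_⟩
      rw [Equiv.swap_self, ← Equiv.Perm.one_def, one_mul, Equiv.Perm.one_apply]
      exact hf' (Equiv.optionCongr k) none (some a)
    · refine ⟨Equiv.mulLeft (Equiv.swap a b), fun k => ?_⟩
      rw [abs_sub_comm, Equiv.coe_mulLeft, Equiv.Perm.swap_none_mul_optionCongr_swap_mul]
      exact hf' _ (some a) (some b)

/-- Exponential moments of a function of a uniform random permutation which changes by at most `1`
when the permutation is composed with a transposition. -/
theorem Equiv.Perm.sum_exp_sub_mean_le {α : Type*} [Fintype α] [DecidableEq α] (s : ℝ)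
    (f : Equiv.Perm α → ℝ)
    (hf : ∀ σ x y, |f (σ * Equiv.swap x y) - f σ| ≤ 1) :
    ∑ σ, Real.exp (s * (f σ - (∑ τ, f τ) / Fintype.card (Equiv.Perm α)))
      ≤ Fintype.card (Equiv.Perm α) * Real.cosh s ^ Fintype.card α := by
  revert f
  refine Fintype.induction_empty_option (P := fun α [Fintype α] => ∀ [DecidableEq α]
    (f : Equiv.Perm α → ℝ), (∀ σ x y, |f (σ * Equiv.swap x y) - f σ| ≤ 1) →
    ∑ σ, Real.exp (s * (f σ - (∑ τ, f τ) / Fintype.card (Equiv.Perm α)))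
      ≤ Fintype.card (Equiv.Perm α) * Real.cosh s ^ Fintype.card α) ?_ ?_ ?_ α
  · intro α β _ e ih _ f hf
    let := Fintype.ofEquiv β e.symm
    let : DecidableEq α := Classical.decEq α
    have h := ih (fun σ => f (e.permCongr σ)) (by
      intro σ x y
      convert hf (e.permCongr σ) (e x) (e y) using 4
      ext z
      simp [Equiv.permCongr_apply, Equiv.swap_apply_def, Equiv.symm_apply_eq]
      grind)
    rw [sum_exp_sub_mean_congr e.permCongr s f, ← Fintype.card_congr e.permCongr,
      ← Fintype.card_congr e]
    convert h
  · intro _ f _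
    simp
  · intro α _ ih inst f hf
    let : DecidableEq α := Classical.decEq α
    have h := Equiv.Perm.sum_exp_sub_mean_option_le s ih f (by convert hf)
    convert h

/-! ### The Chernoff bound and the entropy exponent -/

/-- At s = artanh b, the minimiser of exp(-sb) cosh s, one has cosh s = ((1+b)(1-b))^(-1/2). -/
theorem exp_neg_mul_mul_cosh_eq_rpow_h2 {b : ℝ} (h0 : -1 < b) (h1 : b < 1) :
    Real.exp (-((Real.log (1 + b) - Real.log (1 - b)) / 2 * b))
        * Real.cosh ((Real.log (1 + b) - Real.log (1 - b)) / 2)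
      = (2 : ℝ) ^ (-(1 - h2 ((1 - b) / 2))) := by
  have hp : 0 < 1 + b := by linarith
  have hm : 0 < 1 - b := by linarith
  set x := Real.log (1 + b) with hx
  set y := Real.log (1 - b) with hy
  have hcosh : Real.cosh ((x - y) / 2) = Real.exp (-(x + y) / 2) := by
    have e1 : Real.exp ((x - y) / 2) = Real.exp (-(x + y) / 2) * (1 + b) := by
      rw [← Real.exp_log hp, ← Real.exp_add, ← hx]
      ring_nf
    have e2 : Real.exp (-((x - y) / 2)) = Real.exp (-(x + y) / 2) * (1 - b) := by
      rw [← Real.exp_log hm, ← Real.exp_add, ← hy]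
      ring_nf
    rw [Real.cosh_eq, e1, e2]
    ring
  have hl : Real.log 2 ≠ 0 := (Real.log_pos one_lt_two).ne'
  rw [hcosh, ← Real.exp_add, Real.rpow_def_of_pos two_pos, h2]
  congr 1
  rw [show 1 - (1 - b) / 2 = (1 + b) / 2 by ring, Real.logb, Real.logb,
    Real.log_div hp.ne' two_ne_zero, Real.log_div hm.ne' two_ne_zero, ← hx, ← hy]
  field_simp
  ring

theorem h2_le_one (x : ℝ) : h2 x ≤ 1 := by
  have hl : 0 < Real.log 2 := Real.log_pos one_lt_two
  have h := Real.binEntropy_le_log_two (p := x)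
  rw [Real.binEntropy, Real.log_inv, Real.log_inv] at h
  have : h2 x = (x * -Real.log x + (1 - x) * -Real.log (1 - x)) / Real.log 2 := by
    rw [h2, Real.logb, Real.logb]
    ring
  rwa [this, div_le_one hl]

section Uniform

variable {Ω : Type*} [Fintype Ω] [MeasurableSpace Ω] [MeasurableSingletonClass Ω]

theorem uniformOn_univ_real_eq (S : Set Ω) [DecidablePred (· ∈ S)] :
    (uniformOn (Set.univ : Set Ω)).real S
      = (Finset.univ.filter (· ∈ S)).card / Fintype.card Ω := by
  have hS : S = ((Finset.univ.filter (· ∈ S) : Finset Ω) : Set Ω) := by simp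
  rw [measureReal_def, uniformOn_univ]
  conv_lhs => rw [hS, Measure.count_apply_finset]
  simp

theorem integral_uniformOn_univ [Nonempty Ω] (f : Ω → ℝ) :
    ∫ ω, f ω ∂(uniformOn (Set.univ : Set Ω)) = (∑ ω, f ω) / Fintype.card Ω := by
  classical
  have := isProbabilityMeasure_uniformOn (Set.finite_univ (α := Ω)) Set.univ_nonempty
  rw [integral_fintype Integrable.of_finite, Finset.sum_div]
  refine Finset.sum_congr rfl fun ω _ => ?_
  rw [uniformOn_univ_real_eq]
  have : (Finset.univ.filter (· ∈ ({ω} : Set Ω))) = {ω} := by ext; simp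
  rw [this, Finset.card_singleton, smul_eq_mul]
  ring

/-- The two-sided Chernoff bound for a random variable whose centred moment generating function is
dominated by that of a sum of `N` independent random signs. -/
theorem uniformOn_real_le_abs_sub_integral_le [Nonempty Ω] (f : Ω → ℝ) (N : ℕ)
    (hf : ∀ s : ℝ, ∑ ω, Real.exp (s * (f ω - (∑ τ, f τ) / Fintype.card Ω))
      ≤ Fintype.card Ω * Real.cosh s ^ N)
    {b : ℝ} (h0 : 0 ≤ b) (h1 : b < 1) :
    (uniformOn (Set.univ : Set Ω)).real
        {ω | b * N ≤ |f ω - ∫ τ, f τ ∂(uniformOn (Set.univ : Set Ω))|}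
      ≤ 2 * ((2 : ℝ) ^ (-(1 - h2 ((1 - b) / 2)))) ^ N := by
  classical
  have hc : (0 : ℝ) < Fintype.card Ω := by exact_mod_cast Fintype.card_pos
  rw [uniformOn_univ_real_eq, integral_uniformOn_univ, div_le_iff₀ hc,
    ← exp_neg_mul_mul_cosh_eq_rpow_h2 (by linarith) h1]
  set s := (Real.log (1 + b) - Real.log (1 - b)) / 2 with hs
  have hs0 : 0 ≤ s := by
    have := Real.log_le_log (show 0 < 1 - b by linarith) (show 1 - b ≤ 1 + b by linarith)
    rw [hs]
    linarith
  set μ := (∑ τ, f τ) / (Fintype.card Ω : ℝ)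
  -- Markov for both tails at once: each point of the event makes one of the two exponentials at
  -- least exp(sbN).
  have key : ((Finset.univ.filter (· ∈ {ω | b * N ≤ |f ω - μ|})).card : ℝ) * Real.exp (s * (b * N))
      ≤ ∑ ω, Real.exp (s * (f ω - μ)) + ∑ ω, Real.exp (-s * (f ω - μ)) := by
    rw [← Finset.sum_add_distrib, ← nsmul_eq_mul, ← Finset.sum_const]
    refine (Finset.sum_le_sum fun ω hω => ?_).trans
      (Finset.sum_le_sum_of_subset_of_nonneg (Finset.filter_subset _ _)
        fun ω _ _ => by positivity)
    have hω' : b * N ≤ |f ω - μ| := (Finset.mem_filter.1 hω).2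
    rcases le_abs.1 hω' with h | h
    · have : Real.exp (s * (b * N)) ≤ Real.exp (s * (f ω - μ)) :=
        Real.exp_le_exp.2 (mul_le_mul_of_nonneg_left h hs0)
      linarith [Real.exp_pos (-s * (f ω - μ))]
    · have : Real.exp (s * (b * N)) ≤ Real.exp (-s * (f ω - μ)) :=
        Real.exp_le_exp.2 (by linarith [mul_le_mul_of_nonneg_left h hs0])
      linarith [Real.exp_pos (s * (f ω - μ))]
  have h2' := hf (-s)
  rw [Real.cosh_neg] at h2'
  rw [mul_pow, ← Real.exp_nat_mul, show (N : ℝ) * -(s * b) = -(s * (b * N)) by ring, Real.exp_neg]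
  have hpos := Real.exp_pos (s * (b * N))
  rw [← le_div_iff₀ hpos] at key
  refine key.trans ?_
  rw [div_le_iff₀ hpos]
  calc _ ≤ Fintype.card Ω * Real.cosh s ^ N + Fintype.card Ω * Real.cosh s ^ N := add_le_add (hf s) h2'
    _ = _ := by
      field_simp
      ring

end Uniform

theorem sum_exp_sub_mean_equiv_le {A B : Type*} [Fintype A] [Fintype B] [DecidableEq A]
    [DecidableEq B] (s : ℝ) (σ₀ : A ≃ B) (f : A ≃ B → ℝ)
    (hf : ∀ σ x y, |f ((Equiv.swap x y).trans σ) - f σ| ≤ 1) :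
    ∑ σ, Real.exp (s * (f σ - (∑ τ, f τ) / Fintype.card (A ≃ B)))
      ≤ Fintype.card (A ≃ B) * Real.cosh s ^ Fintype.card A := by
  let e : Equiv.Perm A ≃ (A ≃ B) := Equiv.equivCongr (Equiv.refl A) σ₀
  rw [sum_exp_sub_mean_congr e s f, ← Fintype.card_congr e]
  exact Equiv.Perm.sum_exp_sub_mean_le s (fun σ => f (e σ)) fun σ x y => hf (e σ) x y

/-! ### Component counts and degree sums -/

/-- Let `φ` send a vertex to its component in `G`, after replacing the component of `v` by that of
`u`. If `φ` is constant along the edges of `H`, that is, if adding an edge `u v` to `G` connects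
the ends of every edge of `H`, then `H` has at least as many components as `G` less one. -/
theorem SimpleGraph.card_connectedComponent_le_succ {V : Type*} [Finite V] (G H : SimpleGraph V)
    (u v : V) [DecidableEq G.ConnectedComponent]
    (φ : V → G.ConnectedComponent)
    (hφ : ∀ x, φ x = if G.connectedComponentMk x = G.connectedComponentMk v
      then G.connectedComponentMk u else G.connectedComponentMk x)
    (h : ∀ x y, H.Adj x y → φ x = φ y) :
    Nat.card G.ConnectedComponent ≤ Nat.card H.ConnectedComponent + 1 := by
  have hwalk : ∀ (x y : V) (p : H.Walk x y), φ x = φ y := by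
    intro x y p
    induction p with
    | nil => rfl
    | cons hadj _ ih => exact (h _ _ hadj).trans ih
  -- The extra point `none` covers the component of `v`, which `φ` may miss.
  let ψ : Option H.ConnectedComponent → G.ConnectedComponent := fun o =>
    o.elim (G.connectedComponentMk v)
      (SimpleGraph.ConnectedComponent.lift φ fun x y p _ => hwalk x y p)
  have hψ : Function.Surjective ψ := by
    intro c
    induction c using SimpleGraph.ConnectedComponent.ind with
    | h x =>
      by_cases hx : G.connectedComponentMk x = G.connectedComponentMk v
      · exact ⟨none, hx.symm⟩
      · exact ⟨some (H.connectedComponentMk x), by simp [ψ, hφ, hx]⟩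
  have := Nat.card_le_card_of_surjective ψ hψ
  rwa [Finite.card_option] at this

/-- Polynomials `p` describing the degrees from the edge perspective: `∫₀¹ p` is the number of
nodes divided by the number of edges. -/
theorem integral_eval_mul_sum_eq_card {k : ℕ} (p : ℝ[X]) (d : Fin k → ℕ) (hd : ∀ v, 0 < d v)
    (h : ∀ i : ℕ, 1 ≤ i → (i : ℝ) * ((Finset.univ.filter fun v => d v = i).card : ℝ)
      = p.coeff (i - 1) * ((∑ v, d v : ℕ) : ℝ)) :
    (∫ x in (0 : ℝ)..1, p.eval x) * ((∑ v, d v : ℕ) : ℝ) = k := by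
  -- Large enough for all coefficients of `p` and for every `d v - 1`.
  set M := max (p.natDegree + 1) (∑ v, d v) with hM
  have hint : ∫ x in (0 : ℝ)..1, p.eval x = ∑ i ∈ Finset.range M, p.coeff i / (i + 1) := by
    have : ∀ x : ℝ, p.eval x = ∑ i ∈ Finset.range M, p.coeff i * x ^ i := fun x =>
      p.eval_eq_sum_range' (lt_of_lt_of_le (Nat.lt_succ_self _) (le_max_left _ _)) x
    simp only [this]
    rw [intervalIntegral.integral_finsetSum
      fun i _ => (Continuous.intervalIntegrable (by fun_prop) _ _)]
    refine Finset.sum_congr rfl fun i _ => ?_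
    rw [intervalIntegral.integral_const_mul, integral_pow]
    simp [div_eq_mul_inv]
  rw [hint, Finset.sum_mul]
  have hterm : ∀ i ∈ Finset.range M, p.coeff i / (i + 1) * ((∑ v, d v : ℕ) : ℝ)
      = ((Finset.univ.filter fun v => d v - 1 = i).card : ℝ) := by
    intro i _
    have hi := h (i + 1) (by omega)
    have hset : (Finset.univ.filter fun v => d v - 1 = i)
        = Finset.univ.filter fun v => d v = i + 1 :=
      Finset.filter_congr fun v _ => by have := hd v; omega
    rw [hset, div_mul_eq_mul_div, div_eq_iff (by positivity), mul_comm _ ((i : ℝ) + 1)]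
    push_cast at hi ⊢
    exact hi.symm
  rw [Finset.sum_congr rfl hterm, ← Nat.cast_sum, ← Finset.card_eq_sum_card_fiberwise]
  · simp
  · intro v _
    have h1 : d v ≤ ∑ v, d v := Finset.single_le_sum (fun _ _ => Nat.zero_le _) (Finset.mem_univ v)
    have h2 := le_max_right (p.natDegree + 1) (∑ v, d v)
    have := hd v
    simp only [Finset.coe_range, Set.mem_Iio]
    omega

/-! ### Cycle counts in the ensemble -/

namespace LDPC

variable {n : ℕ} {lam rho : ℝ[X]} (𝓔 : LDPC n lam rho)

theorem card_leftSocket : Fintype.card 𝓔.LeftSocket = ∑ v, 𝓔.leftDeg v := by simp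

theorem nonempty_config : Nonempty 𝓔.Config :=
  ⟨Fintype.equivOfCardEq (by simp [𝓔.sum_leftDeg_eq])⟩

theorem le_sum_leftDeg : n ≤ ∑ v, 𝓔.leftDeg v := by
  calc n = ∑ _v : Fin n, 1 := by simp
    _ ≤ _ := Finset.sum_le_sum fun v _ => 𝓔.leftDeg_pos v

theorem beta_eq (σ : 𝓔.Config) :
    𝓔.beta σ = (Fintype.card 𝓔.LeftSocket : ℝ) - (n + 𝓔.m) + (𝓔.graph σ).numComponents := by
  simp [beta, Graph.cyclomaticNumber, graph, Set.ncard_univ]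

instance (σ : 𝓔.Config) : Finite (𝓔.graph σ).vertexSet :=
  inferInstanceAs (Finite (Set.univ : Set (Fin n ⊕ Fin 𝓔.m)))

theorem mk_inl_eq_mk_inr (σ : 𝓔.Config) (s : 𝓔.LeftSocket) :
    (𝓔.graph σ).toSimpleGraph.connectedComponentMk ⟨Sum.inl s.1, trivial⟩
      = (𝓔.graph σ).toSimpleGraph.connectedComponentMk ⟨Sum.inr (σ s).1, trivial⟩ :=
  SimpleGraph.ConnectedComponent.sound
    (SimpleGraph.Adj.reachable ⟨fun h => Sum.inl_ne_inr (congrArg Subtype.val h), s, Or.inl ⟨rfl, rfl⟩⟩)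

/-- Adding only the new edge from `s` to `σ t` to the old graph already connects `t` to `σ s`, by
the path t, σ t, s, σ s; all other edges are unchanged. -/
theorem numComponents_le_swap [DecidableEq 𝓔.LeftSocket] (σ : 𝓔.Config) (s t : 𝓔.LeftSocket) :
    (𝓔.graph σ).numComponents ≤ (𝓔.graph ((Equiv.swap s t).trans σ)).numComponents + 1 := by
  classical
  let mk : Fin n ⊕ Fin 𝓔.m → (𝓔.graph σ).toSimpleGraph.ConnectedComponent := fun x =>
    (𝓔.graph σ).toSimpleGraph.connectedComponentMk ⟨x, trivial⟩
  have hmk : ∀ w, mk (Sum.inl w.1) = mk (Sum.inr (σ w).1) := 𝓔.mk_inl_eq_mk_inr σ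
  let φ : Fin n ⊕ Fin 𝓔.m → (𝓔.graph σ).toSimpleGraph.ConnectedComponent := fun x =>
    if mk x = mk (Sum.inr (σ t).1) then mk (Sum.inl s.1) else mk x
  have key : ∀ w, φ (Sum.inl w.1) = φ (Sum.inr (σ (Equiv.swap s t w)).1) := by
    intro w
    simp only [φ]
    rcases eq_or_ne w s with rfl | hs
    · simp
    rcases eq_or_ne w t with rfl | ht
    · simp [hmk]
    · rw [Equiv.swap_apply_of_ne_of_ne hs ht, hmk]
  refine SimpleGraph.card_connectedComponent_le_succ (𝓔.graph σ).toSimpleGraph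
    (𝓔.graph ((Equiv.swap s t).trans σ)).toSimpleGraph ⟨Sum.inl s.1, trivial⟩
    ⟨Sum.inr (σ t).1, trivial⟩ (fun x => φ x.1) (fun x => rfl) ?_
  rintro ⟨x, _⟩ ⟨y, _⟩ ⟨-, w, ⟨h1, h2⟩ | ⟨h1, h2⟩⟩
  · simp only at h1 h2
    subst h1 h2
    exact key w
  · simp only at h1 h2
    subst h1 h2
    exact (key w).symm

theorem abs_beta_swap_sub_le [DecidableEq 𝓔.LeftSocket] (σ : 𝓔.Config) (s t : 𝓔.LeftSocket) :
    |𝓔.beta ((Equiv.swap s t).trans σ) - 𝓔.beta σ| ≤ 1 := by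
  have h1 := 𝓔.numComponents_le_swap σ s t
  have h2 := 𝓔.numComponents_le_swap ((Equiv.swap s t).trans σ) s t
  have h3 : (Equiv.swap s t).trans ((Equiv.swap s t).trans σ) = σ :=
    Equiv.ext fun w => by simp
  rw [h3] at h2
  rw [beta_eq, beta_eq, abs_le]
  have h1' : ((𝓔.graph σ).numComponents : ℝ)
    ≤ (𝓔.graph ((Equiv.swap s t).trans σ)).numComponents + 1 := by exact_mod_cast h1
  have h2' : ((𝓔.graph ((Equiv.swap s t).trans σ)).numComponents : ℝ)
    ≤ (𝓔.graph σ).numComponents + 1 := by exact_mod_cast h2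
  constructor <;> linarith

theorem numComponents_pos (hn : 0 < n) (σ : 𝓔.Config) : 0 < (𝓔.graph σ).numComponents := by
  have : Nonempty (𝓔.graph σ).toSimpleGraph.ConnectedComponent :=
    ⟨SimpleGraph.connectedComponentMk _ ⟨Sum.inl ⟨0, hn⟩, trivial⟩⟩
  exact Nat.card_pos

/-- Check nodes have positive degree, so every component contains a variable node. -/
theorem numComponents_le (σ : 𝓔.Config) : (𝓔.graph σ).numComponents ≤ n := by
  let f : Fin n → (𝓔.graph σ).toSimpleGraph.ConnectedComponent := fun v =>
    SimpleGraph.connectedComponentMk _ ⟨Sum.inl v, trivial⟩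
  have hf : Function.Surjective f := by
    intro c
    induction c using SimpleGraph.ConnectedComponent.ind with
    | h x =>
      obtain ⟨v | c, hx⟩ := x
      · exact ⟨v, rfl⟩
      · refine ⟨(σ.symm ⟨c, 0, 𝓔.rightDeg_pos c⟩).1, ?_⟩
        have := 𝓔.mk_inl_eq_mk_inr σ (σ.symm ⟨c, 0, 𝓔.rightDeg_pos c⟩)
        simpa only [Equiv.apply_symm_apply] using this
  simpa [Graph.numComponents] using Nat.card_le_card_of_surjective f hf

theorem abs_beta_sub_integral_lt (hn : 0 < n) (σ : 𝓔.Config) :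
    |𝓔.beta σ - ∫ τ, 𝓔.beta τ ∂𝓔.law| < n := by
  have := 𝓔.nonempty_config
  rw [law, integral_uniformOn_univ]
  refine (abs_sub_mean_le 𝓔.beta σ (c := (n : ℝ) - 1) fun τ => ?_).trans_lt (by linarith)
  rw [beta_eq, beta_eq, abs_le]
  have h1 : (1 : ℝ) ≤ (𝓔.graph σ).numComponents := by exact_mod_cast 𝓔.numComponents_pos hn σ
  have h2 : (1 : ℝ) ≤ (𝓔.graph τ).numComponents := by exact_mod_cast 𝓔.numComponents_pos hn τ
  have h3 : ((𝓔.graph σ).numComponents : ℝ) ≤ n := by exact_mod_cast 𝓔.numComponents_le σ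
  have h4 : ((𝓔.graph τ).numComponents : ℝ) ≤ n := by exact_mod_cast 𝓔.numComponents_le τ
  constructor <;> linarith

/-- `(1 - R_d) a_R` is the average left degree. -/
theorem one_sub_designRate_mul_avgRightDegree_mul (hn : 0 < n) :
    (1 - designRate lam rho) * avgRightDegree rho * n = (∑ v, 𝓔.leftDeg v : ℕ) := by
  have hl := integral_eval_mul_sum_eq_card lam 𝓔.leftDeg 𝓔.leftDeg_pos 𝓔.left_fraction
  have hr := integral_eval_mul_sum_eq_card rho 𝓔.rightDeg 𝓔.rightDeg_pos 𝓔.right_fraction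
  rw [← 𝓔.sum_leftDeg_eq] at hr
  have hE : 0 < ∑ v, 𝓔.leftDeg v := hn.trans_le 𝓔.le_sum_leftDeg
  have hm : 𝓔.m ≠ 0 := by
    intro h
    have : IsEmpty (Fin 𝓔.m) := by rw [h]; infer_instance
    rw [𝓔.sum_leftDeg_eq, Fintype.sum_empty] at hE
    exact hE.false
  have hm' : (𝓔.m : ℝ) ≠ 0 := by exact_mod_cast hm
  have hn' : (n : ℝ) ≠ 0 := by exact_mod_cast hn.ne'
  rw [designRate, avgRightDegree]
  generalize (∫ x in (0 : ℝ)..1, lam.eval x) = a at *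
  generalize (∫ x in (0 : ℝ)..1, rho.eval x) = c at *
  have ha : a ≠ 0 := by rintro rfl; simp at hl; exact hn' hl.symm
  have hc : c ≠ 0 := by rintro rfl; simp at hr; exact hm' hr.symm
  rw [← hl]
  field_simp
  ring

end LDPC

/-! ### The concentration inequality -/

theorem theorem6 (n : ℕ) (hn : 0 < n) (lam rho : ℝ[X])
    (hlam : IsDegreeDistribution lam) (hrho : IsDegreeDistribution rho)
    (𝓔 : LDPC n lam rho) (α : ℝ) (hα : 0 ≤ α) (b : ℝ)
    (hb : b = α / ((1 - designRate lam rho) * avgRightDegree rho)) :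
    (b ≤ 1 →
      𝓔.law.real {σ | α * n ≤ |𝓔.beta σ - ∫ τ, 𝓔.beta τ ∂𝓔.law|}
        ≤ 2 * (2 : ℝ) ^ (-((1 - h2 ((1 - b) / 2)) * n))) ∧
    (1 < b →
      𝓔.law {σ | α * n ≤ |𝓔.beta σ - ∫ τ, 𝓔.beta τ ∂𝓔.law|} = 0) := by
  have hdeg := 𝓔.one_sub_designRate_mul_avgRightDegree_mul hn
  set E := ∑ v, 𝓔.leftDeg v with hE
  have hnE : n ≤ E := 𝓔.le_sum_leftDeg
  have hnE' : (n : ℝ) ≤ E := by exact_mod_cast hnE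
  have hn' : (0 : ℝ) < n := by exact_mod_cast hn
  set a := (1 - designRate lam rho) * avgRightDegree rho
  have ha : 0 < a := pos_of_mul_pos_left (by rw [hdeg]; linarith) hn'.le
  have hαb : α * n = b * E := by
    rw [← hdeg, hb]
    field_simp
  have hb0 : 0 ≤ b := by rw [hb]; positivity
  have hempty : 1 ≤ b → {σ | α * n ≤ |𝓔.beta σ - ∫ τ, 𝓔.beta τ ∂𝓔.law|} = ∅ := by
    intro h1
    refine Set.eq_empty_of_forall_notMem fun σ hσ => ?_
    have h2 := 𝓔.abs_beta_sub_integral_lt hn σ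
    have h3 : α * n ≤ |𝓔.beta σ - ∫ τ, 𝓔.beta τ ∂𝓔.law| := hσ
    rw [hαb] at h3
    nlinarith
  refine ⟨fun h1 => ?_, fun h1 => by rw [hempty h1.le, measure_empty]⟩
  -- At b = 1 the optimal s is infinite, so the empty event replaces Chernoff's bound.
  rcases h1.eq_or_lt with h1 | h1
  · rw [hempty h1.ge, measureReal_empty]
    positivity
  have := 𝓔.nonempty_config
  obtain ⟨σ₀⟩ := 𝓔.nonempty_config
  have hmgf : ∀ s : ℝ, _ := fun s =>
    sum_exp_sub_mean_equiv_le s σ₀ 𝓔.beta fun σ x y => 𝓔.abs_beta_swap_sub_le σ x y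
  have key := uniformOn_real_le_abs_sub_integral_le 𝓔.beta _ hmgf hb0 h1
  rw [𝓔.card_leftSocket, ← hE, ← hαb] at key
  refine key.trans (mul_le_mul_of_nonneg_left ?_ zero_le_two)
  have hle : (2 : ℝ) ^ (-(1 - h2 ((1 - b) / 2))) ≤ 1 :=
    Real.rpow_le_one_of_one_le_of_nonpos one_le_two (by linarith [h2_le_one ((1 - b) / 2)])
  calc ((2 : ℝ) ^ (-(1 - h2 ((1 - b) / 2)))) ^ E
      ≤ ((2 : ℝ) ^ (-(1 - h2 ((1 - b) / 2)))) ^ n :=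
        pow_le_pow_of_le_one (Real.rpow_nonneg zero_le_two _) hle hnE
    _ = _ := by
      rw [← Real.rpow_natCast, ← Real.rpow_mul zero_le_two, neg_mul]
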